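/- Let $(V,d)$ be a non-empty compact length space, i.e. a compact metric space in which $d(x,y)$ is, for all $x,y\in V$, the infimum of the lengths of rectifiable paths from $x$ to $y$, and let $f\colon V\to\mathbb{R}$ be continuous. For $\epsilon>0$, the $\epsilon$-adjacency graph has vertex set $V$, with $x\sim y$ if and only if $d(x,y)\le\epsilon$ (so $x\sim x$). Given a bounded $g\colon V\to\mathbb{R}$, consider the following game of horizon $n$ on this graph. A token starts at $x_0\in V$. At each of the $n$ steps Player II pays Player I the amount $f(x)$, where $x$ is the current position; then a fair coin, independent of the previous tosses, is tossed and the winner moves the token to a neighbour of $x$. At the end Player II pays Player I the amount $g(y)$, where $y$ is the final position. A strategy chooses, at each step, a neighbour of the current position as a function of the positions visited and the coin tosses made so far. If $F_n(S_{\mathrm I},S_{\mathrm{II}})(x_0)$ denotes the expected total payment when the players use the strategies $S_{\mathrm I},S_{\mathrm{II}}$, the game value is $$u_n(x_0)=\sup_{S_{\mathrm I}}\inf_{S_{\mathrm{II}}}F_n(S_{\mathrm I},S_{\mathrm{II}})(x_0)=\inf_{S_{\mathrm{II}}}\sup_{S_{\mathrm I}}F_n(S_{\mathrm I},S_{\mathrm{II}})(x_0).$$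 For every $\epsilon>0$ these values exist (the two expressions agree for all bounded $g$, all $n$ and all $x_0$), and there is exactly one real number $c_f(\epsilon)$ (Player I's long term advantage) such that, for every bounded $g\colon V\to\mathbb{R}$, the sequence of functions $(u_n-n\,c_f(\epsilon))_{n\ge 0}$ is uniformly bounded on $V$. Moreover, the limit $\lim_{\epsilon\downarrow 0}c_f(\epsilon)$ exists in $\mathbb{R}$. -/

import Mathlib

open Filter Topology

/-- A metric space is a length space if the distance between any two points is the infimum of the
lengths (total variations) of the paths joining them. Paths that are not rectifiable have length
`∞`, so they do not contribute, and two points that no rectifiable path joins violate the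
equation because `edist` is finite. -/
def IsLengthSpace (V : Type*) [MetricSpace V] : Prop :=
  ∀ x y : V, edist x y = ⨅ γ : Path x y, eVariationOn (⇑γ) Set.univ

/-- The edge relation of the `ε`-adjacency graph. Every vertex has a loop. -/
def EpsAdj {V : Type*} [MetricSpace V] (ε : ℝ) (x y : V) : Prop :=
  dist x y ≤ ε

namespace TugOfWar

/-- A strategy in the game of horizon `n` on the graph with edge relation `Adj`. Steps are numbered
from `0`; at step `k` the strategy is given the positions `x₀, …, xₖ` visited so far and the
`k + 1` coin tosses made so far, the one of the present step included, and
chooses a neighbour of the current position `xₖ`. -/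
structure Strategy {V : Type*} (Adj : V → V → Prop) (n : ℕ) where
  move : (k : Fin n) → (Fin (k + 1) → V) → (Fin (k + 1) → Bool) → V
  adj_move : ∀ (k : Fin n) (pos : Fin (k + 1) → V) (coins : Fin (k + 1) → Bool),
    Adj (pos (Fin.last k)) (move k pos coins)

/-- The positions `x₀ = x, x₁, …, xₖ` of the token after `k ≤ n` steps when the coin tosses are
`ω`: at each step the token is moved by Player I (strategy `S`) if the toss is `true`, and by
Player II (strategy `T`) if it is `false`. -/
def history {V : Type*} {Adj : V → V → Prop} {n : ℕ} (S T : Strategy Adj n) (x : V)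
    (ω : Fin n → Bool) : (k : ℕ) → k ≤ n → Fin (k + 1) → V
  | 0, _ => fun _ => x
  | k + 1, h =>
    let past : Fin (k + 1) → V := history S T x ω k (Nat.le_of_succ_le h)
    let coins : Fin (k + 1) → Bool := fun i => ω (Fin.castLE h i)
    Fin.snoc past
      (if ω ⟨k, h⟩ = true then S.move ⟨k, h⟩ past coins else T.move ⟨k, h⟩ past coins)

/-- The position of the token after `k ≤ n` steps. -/
def position {V : Type*} {Adj : V → V → Prop} {n : ℕ} (S T : Strategy Adj n) (x : V)
    (ω : Fin n → Bool) (k : ℕ) (h : k ≤ n) : V :=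
  history S T x ω k h (Fin.last k)

/-- What Player II pays to Player I in total: the running payoff `f` of the position before each of
the `n` steps, and the terminal payoff `g` of the final position. -/
def payoff {V : Type*} {Adj : V → V → Prop} {n : ℕ} (f g : V → ℝ) (S T : Strategy Adj n) (x : V)
    (ω : Fin n → Bool) : ℝ :=
  (∑ k : Fin n, f (position S T x ω k k.isLt.le)) + g (position S T x ω n le_rfl)

/-- The expected payoff, the `n` coin tosses being fair and independent. -/
noncomputable def expectedPayoff {V : Type*} {Adj : V → V → Prop} {n : ℕ} (f g : V → ℝ)
    (S T : Strategy Adj n) (x : V) : ℝ :=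
  (∑ ω : Fin n → Bool, payoff f g S T x ω) / 2 ^ n

/-- The value for Player I of the game of horizon `n` started at `x`. -/
noncomputable def valueI {V : Type*} (Adj : V → V → Prop) (f g : V → ℝ) (n : ℕ) (x : V) : ℝ :=
  ⨆ S : Strategy Adj n, ⨅ T : Strategy Adj n, expectedPayoff f g S T x

/-- The value for Player II of the game of horizon `n` started at `x`. -/
noncomputable def valueII {V : Type*} (Adj : V → V → Prop) (f g : V → ℝ) (n : ℕ) (x : V) : ℝ :=
  ⨅ T : Strategy Adj n, ⨆ S : Strategy Adj n, expectedPayoff f g S T x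

/-- `u` is the sequence of game values with running payoff `f` and terminal payoff `g`: for every
horizon and every starting vertex, the values for the two players agree and are given by `u`. -/
def IsGameValues {V : Type*} (Adj : V → V → Prop) (f g : V → ℝ) (u : ℕ → V → ℝ) : Prop :=
  ∀ (n : ℕ) (x : V), valueI Adj f g n x = u n x ∧ valueII Adj f g n x = u n x

/-- `c` is Player I's long term advantage for the running payoff `f`: for every bounded terminal
payoff `g` the game has values `uₙ`, and the functions `uₙ - n c` are bounded uniformly in `n`. -/
def IsLongTermAdvantage {V : Type*} (Adj : V → V → Prop) (f : V → ℝ) (c : ℝ) : Prop :=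
  ∀ g : V → ℝ, (∃ K : ℝ, ∀ x, |g x| ≤ K) →
    ∃ u : ℕ → V → ℝ, IsGameValues Adj f g u ∧
      ∃ C : ℝ, ∀ (n : ℕ) (x : V), |u n x - n * c| ≤ C

end TugOfWar

/-!
Let `T u = f + (sup u + inf u) / 2`, the supremum and infimum being over the neighbours of a vertex.
Moving to a nearly optimal neighbour at each step shows that the game has values, namely
`uₙ = Tⁿ g` (`isGameValues_iter`). The operator `T` is monotone and commutes with the addition of
constants, so it is nonexpansive, and it suffices to treat `g = 0`.

The main tool is an almost convexity property: if `w + κ ≤ (sup w + inf w) / 2` near `x`, then the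
suprema `a j` of `w` over the graph balls of radius `j` around `x` satisfy
`a (j + 2) - 2 a (j + 1) + a j ≥ 2 κ` (`ballSup_second_difference`). On a graph of finite diameter
`a` is eventually constant, so this bounds its increments and the oscillation of `w`. As `uₙ₊₁ - uₙ`
is bounded, the oscillation of `uₙ` is bounded in `n`; Fekete's lemma, applied to the values at a
base point, then gives the growth rate `c` with `uₙ - n c` bounded (`exists_growth_rate`).
The rate `c` is also the supremum of the constants `c'` for which there is a bounded `w` with
`w + c' ≤ T w` (`exists_subsolution`, `le_growth_rate`).

In a length space a point at distance less than `k δ` is reached in `k` steps of size `δ`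
(`reach_of_dist_lt`). If `w` is a subsolution for the step size `δ` and `m δ ≤ ε < (m + 1) δ`, let
`v` be the supremum of `w` over `ε`-balls, divided by `m²`. The supremum of `m² v` over the `ε`-ball
around `x` is at least `a (2 m)`, its infimum is at least `a 0`, and `m² v x ≤ a (m + 1)`. Up to one
increment of `a`, which is of order `1 / δ`, the second difference of `m² v` is therefore at least
`m²` times that of `a`. So `v` is almost a subsolution for the step size `ε` with the same constant
(`exists_subsolution_of_small_step`), whence `c δ ≤ c ε + o(1)` when first `δ` and then
`ε` tends to `0`. Thus the upper limit of `c` is at most its lower limit.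
-/

namespace TugOfWar

variable {V : Type*} {Adj : V → V → Prop}

/-! ### The one-step operator of the game -/

/-- The supremum of `u` over the neighbours of `x`. -/
noncomputable def nbrSup (Adj : V → V → Prop) (u : V → ℝ) (x : V) : ℝ :=
  ⨆ y : {y // Adj x y}, u y

/-- The infimum of `u` over the neighbours of `x`. -/
noncomputable def nbrInf (Adj : V → V → Prop) (u : V → ℝ) (x : V) : ℝ :=
  ⨅ y : {y // Adj x y}, u y

/-- The dynamic programming operator: the value of the game with one step to go when the terminal
payoff is `u`. -/
noncomputable def step (Adj : V → V → Prop) (f u : V → ℝ) (x : V) : ℝ :=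
  f x + (nbrSup Adj u x + nbrInf Adj u x) / 2

/-- A real function that is bounded in absolute value. -/
def IsBdd (u : V → ℝ) : Prop := ∃ K : ℝ, ∀ x, |u x| ≤ K

theorem IsBdd.bddAbove {u : V → ℝ} (hu : IsBdd u) {ι : Type*} (i : ι → V) :
    BddAbove (Set.range fun k => u (i k)) := by
  obtain ⟨K, hK⟩ := hu
  exact ⟨K, by rintro _ ⟨k, rfl⟩; exact (abs_le.1 (hK _)).2⟩

theorem IsBdd.bddBelow {u : V → ℝ} (hu : IsBdd u) {ι : Type*} (i : ι → V) :
    BddBelow (Set.range fun k => u (i k)) := by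
  obtain ⟨K, hK⟩ := hu
  exact ⟨-K, by rintro _ ⟨k, rfl⟩; exact (abs_le.1 (hK _)).1⟩

theorem IsBdd.const (c : ℝ) : IsBdd fun _ : V => c := ⟨|c|, fun _ => le_rfl⟩

theorem le_nbrSup {u : V → ℝ} (hu : IsBdd u) {x y : V} (h : Adj x y) : u y ≤ nbrSup Adj u x :=
  le_ciSup (hu.bddAbove ((↑) : {y // Adj x y} → V)) ⟨y, h⟩

theorem nbrInf_le {u : V → ℝ} (hu : IsBdd u) {x y : V} (h : Adj x y) : nbrInf Adj u x ≤ u y :=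
  ciInf_le (hu.bddBelow ((↑) : {y // Adj x y} → V)) ⟨y, h⟩

section Reflexive

variable (hr : ∀ x, Adj x x)
include hr

theorem nbrSup_le {u : V → ℝ} {x : V} {a : ℝ} (h : ∀ y, Adj x y → u y ≤ a) :
    nbrSup Adj u x ≤ a :=
  have : Nonempty {y // Adj x y} := ⟨⟨x, hr x⟩⟩
  ciSup_le fun y => h y.1 y.2

theorem le_nbrInf {u : V → ℝ} {x : V} {a : ℝ} (h : ∀ y, Adj x y → a ≤ u y) :
    a ≤ nbrInf Adj u x :=
  have : Nonempty {y // Adj x y} := ⟨⟨x, hr x⟩⟩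
  le_ciInf fun y => h y.1 y.2

/-- The operator is monotone and commutes with the addition of constants. -/
theorem step_le_step {f u v : V → ℝ} (hu : IsBdd u) (hv : IsBdd v) {d : ℝ}
    (h : ∀ x, u x ≤ v x + d) (x : V) : step Adj f u x ≤ step Adj f v x + d := by
  have h1 : nbrSup Adj u x ≤ nbrSup Adj v x + d :=
    nbrSup_le hr fun y hy => (h y).trans (by linarith [le_nbrSup hv hy])
  have h2 : nbrInf Adj u x - d ≤ nbrInf Adj v x :=
    le_nbrInf hr fun y hy => by linarith [h y, nbrInf_le hu hy]
  unfold step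
  linarith

theorem abs_step_le {f u : V → ℝ} {M K : ℝ} (hf : ∀ x, |f x| ≤ M) (hu : ∀ x, |u x| ≤ K) (x : V) :
    |step Adj f u x| ≤ K + M := by
  have hb : IsBdd u := ⟨K, hu⟩
  have h1 : nbrSup Adj u x ≤ K := nbrSup_le hr fun y _ => (abs_le.1 (hu y)).2
  have h2 : -K ≤ nbrInf Adj u x := le_nbrInf hr fun y _ => (abs_le.1 (hu y)).1
  have h3 := le_nbrSup hb (hr x)
  have h4 := nbrInf_le hb (hr x)
  have h5 := abs_le.1 (hf x)
  have h6 := abs_le.1 (hu x)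
  unfold step
  exact abs_le.2 ⟨by linarith, by linarith⟩

end Reflexive

/-- The iterates of the operator on the terminal payoff `g`; they are the game values. -/
noncomputable def iter (Adj : V → V → Prop) (f g : V → ℝ) : ℕ → V → ℝ
  | 0 => g
  | n + 1 => step Adj f (iter Adj f g n)

section Reflexive

variable (hr : ∀ x, Adj x x)
include hr

theorem abs_iter_le {f g : V → ℝ} {M K : ℝ} (hf : ∀ x, |f x| ≤ M) (hg : ∀ x, |g x| ≤ K) (n : ℕ) :
    ∀ x, |iter Adj f g n x| ≤ K + n * M := by
  induction n with
  | zero => simpa [iter] using hg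
  | succ n ih =>
    intro x
    refine (abs_step_le hr hf ih x).trans (le_of_eq ?_)
    push_cast
    ring

theorem isBdd_iter {f g : V → ℝ} (hf : IsBdd f) (hg : IsBdd g) (n : ℕ) :
    IsBdd (iter Adj f g n) := by
  obtain ⟨M, hM⟩ := hf
  obtain ⟨K, hK⟩ := hg
  exact ⟨_, abs_iter_le hr hM hK n⟩

theorem iter_le_iter {f u v : V → ℝ} (hf : IsBdd f) (hu : IsBdd u) (hv : IsBdd v) {d : ℝ}
    (h : ∀ x, u x ≤ v x + d) (n : ℕ) : ∀ x, iter Adj f u n x ≤ iter Adj f v n x + d := by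
  induction n with
  | zero => exact h
  | succ n ih => exact step_le_step hr (isBdd_iter hr hf hu n) (isBdd_iter hr hf hv n) ih

omit hr in
theorem iter_add (f g : V → ℝ) (m n : ℕ) :
    iter Adj f g (m + n) = iter Adj f (iter Adj f g n) m := by
  induction m with
  | zero => rw [Nat.zero_add]; rfl
  | succ m ih => rw [Nat.succ_add]; simp only [iter, ih]

/-- A subsolution with constant `c` gives a linear lower bound for the iterates. -/
theorem add_mul_le_iter {f v : V → ℝ} (hf : IsBdd f) (hv : IsBdd v) {c : ℝ}
    (h : ∀ x, v x + c ≤ step Adj f v x) (n : ℕ) : ∀ x, v x + n * c ≤ iter Adj f v n x := by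
  induction n with
  | zero => simp [iter]
  | succ n ih =>
    intro x
    have h1 := step_le_step (f := f) hr hv (isBdd_iter hr hf hv n) (d := -(n * c))
      (fun y => by linarith [ih y]) x
    have h2 := h x
    simp only [iter]
    push_cast
    linarith

end Reflexive

/-! ### Suprema over graph balls -/

/-- `Reach Adj k x y` says that `y` can be reached from `x` in `k` steps along the edges. -/
def Reach (Adj : V → V → Prop) : ℕ → V → V → Prop
  | 0, x, y => x = y
  | k + 1, x, y => ∃ z, Reach Adj k x z ∧ Adj z y

theorem Reach.trans {j k : ℕ} {x y z : V} (h : Reach Adj j x y) (h' : Reach Adj k y z) :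
    Reach Adj (j + k) x z := by
  induction k generalizing z with
  | zero => obtain rfl : y = z := h'; exact h
  | succ k ih => obtain ⟨w, hw, hz⟩ := h'; exact ⟨w, ih hw, hz⟩

theorem reach_one {x y : V} (h : Adj x y) : Reach Adj 1 x y := ⟨x, rfl, h⟩

theorem reach_self (hr : ∀ x, Adj x x) (k : ℕ) (x : V) : Reach Adj k x x := by
  induction k with
  | zero => rfl
  | succ k ih => exact ⟨x, ih, hr x⟩

/-- The supremum of `u` over the graph ball of radius `k` around `x`. -/
noncomputable def ballSup (Adj : V → V → Prop) (u : V → ℝ) (x : V) (k : ℕ) : ℝ :=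
  ⨆ y : {y // Reach Adj k x y}, u y

theorem le_ballSup {u : V → ℝ} (hu : IsBdd u) {k : ℕ} {x y : V} (h : Reach Adj k x y) :
    u y ≤ ballSup Adj u x k :=
  le_ciSup (hu.bddAbove ((↑) : {y // Reach Adj k x y} → V)) ⟨y, h⟩

theorem ballSup_zero (u : V → ℝ) (x : V) : ballSup Adj u x 0 = u x := by
  have : Nonempty {y // Reach Adj 0 x y} := ⟨⟨x, rfl⟩⟩
  have h : ∀ y : {y // Reach Adj 0 x y}, u y = u x := fun y => congrArg u y.2.symm
  simp only [ballSup, h, ciSup_const]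

section Reflexive

variable (hr : ∀ x, Adj x x)
include hr

theorem ballSup_le {u : V → ℝ} {k : ℕ} {x : V} {a : ℝ} (h : ∀ y, Reach Adj k x y → u y ≤ a) :
    ballSup Adj u x k ≤ a :=
  have : Nonempty {y // Reach Adj k x y} := ⟨⟨x, reach_self hr k x⟩⟩
  ciSup_le fun y => h y.1 y.2

theorem exists_lt_of_lt_ballSup {u : V → ℝ} {k : ℕ} {x : V} {a : ℝ} (h : a < ballSup Adj u x k) :
    ∃ y, Reach Adj k x y ∧ a < u y := by
  by_contra! hc
  exact absurd (ballSup_le hr hc) (not_le.2 h)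

/-- Where `w` is a subsolution, the suprema over balls of consecutive radii are almost convex:
from a (near) maximum point in the ball of radius `k + 1` one can step out of the ball, and one can
also step back into the ball of radius `k`. -/
theorem ballSup_second_difference {w : V → ℝ} (hw : IsBdd w) (hs : ∀ x y, Adj x y → Adj y x)
    {k : ℕ} {x : V} {κ : ℝ}
    (h : ∀ y, Reach Adj (k + 1) x y → w y + κ ≤ (nbrSup Adj w y + nbrInf Adj w y) / 2) :
    2 * κ ≤ ballSup Adj w x (k + 2) - 2 * ballSup Adj w x (k + 1) + ballSup Adj w x k := by
  refine le_of_forall_pos_le_add fun τ hτ => ?_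
  obtain ⟨y, hy, hlt⟩ := exists_lt_of_lt_ballSup hr
    (show ballSup Adj w x (k + 1) - τ / 2 < ballSup Adj w x (k + 1) by linarith)
  have h1 : nbrSup Adj w y ≤ ballSup Adj w x (k + 2) :=
    nbrSup_le hr fun z hz => le_ballSup hw ⟨y, hy, hz⟩
  obtain ⟨z, hz, hzy⟩ := id hy
  have h2 : nbrInf Adj w y ≤ ballSup Adj w x k :=
    (nbrInf_le hw (hs _ _ hzy)).trans (le_ballSup hw hz)
  linarith [h y hy]

/-- In a graph of diameter at most `N` the supremum over balls is eventually constant, so almost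
convexity bounds its increments. -/
theorem ballSup_increment_le {w : V → ℝ} (hw : IsBdd w) (hs : ∀ x y, Adj x y → Adj y x)
    {N : ℕ} (hN : ∀ x y, Reach Adj N x y) {κ : ℝ}
    (h : ∀ y, w y - κ ≤ (nbrSup Adj w y + nbrInf Adj w y) / 2) (x : V) (k : ℕ) :
    ballSup Adj w x (k + 1) - ballSup Adj w x k ≤ 2 * κ * N := by
  have hbig : ∀ k, N ≤ k → ballSup Adj w x (k + 1) - ballSup Adj w x k ≤ 0 := by
    intro k hk
    refine sub_nonpos.2 (ballSup_le hr fun y _ => le_ballSup hw ?_)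
    have := (hN x y).trans (reach_self hr (k - N) y)
    rwa [Nat.add_sub_cancel' hk] at this
  have key : ∀ i k, N ≤ k + i →
      ballSup Adj w x (k + 1) - ballSup Adj w x k ≤ 2 * κ * i := by
    intro i
    induction i with
    | zero => intro k hk; simpa using hbig k hk
    | succ i ih =>
      intro k hk
      have h1 := ih (k + 1) (by omega)
      have h2 := ballSup_second_difference hr hw hs (k := k) (x := x) (κ := -κ)
        (fun y _ => by linarith [h y])
      push_cast
      linarith
  exact key N k (by omega)

theorem oscillation_le {w : V → ℝ} (hw : IsBdd w) (hs : ∀ x y, Adj x y → Adj y x)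
    {N : ℕ} (hN : ∀ x y, Reach Adj N x y) {κ : ℝ}
    (h : ∀ y, w y - κ ≤ (nbrSup Adj w y + nbrInf Adj w y) / 2) (x y : V) :
    w y ≤ w x + 2 * κ * N * N := by
  have h1 : ∀ k : ℕ, ballSup Adj w x k ≤ w x + 2 * κ * N * k := by
    intro k
    induction k with
    | zero => simp [ballSup_zero]
    | succ k ih =>
      have := ballSup_increment_le hr hw hs hN h x k
      push_cast
      linarith
  exact (le_ballSup hw (hN x y)).trans (h1 N)

/-! ### The long term advantage of the iterates -/

/-- Consecutive iterates differ by at most `sup |f|`, because the operator is nonexpansive. -/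
theorem iter_le_iter_succ {f : V → ℝ} {M : ℝ} (hf : ∀ x, |f x| ≤ M) (n : ℕ) (x : V) :
    iter Adj f (fun _ => 0) n x ≤ iter Adj f (fun _ => 0) (n + 1) x + M ∧
      iter Adj f (fun _ => 0) (n + 1) x ≤ iter Adj f (fun _ => 0) n x + M := by
  have h0 : IsBdd fun _ : V => (0 : ℝ) := IsBdd.const 0
  have h1 : ∀ x, |iter Adj f (fun _ => 0) 1 x| ≤ M := fun x => by
    simpa using abs_iter_le hr hf (g := fun _ => 0) (K := 0) (by simp) 1 x
  rw [iter_add f _ n 1]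
  exact ⟨iter_le_iter hr ⟨M, hf⟩ h0 ⟨M, h1⟩ (fun y => by linarith [(abs_le.1 (h1 y)).1]) n x,
    iter_le_iter hr ⟨M, hf⟩ ⟨M, h1⟩ h0 (fun y => by linarith [(abs_le.1 (h1 y)).2]) n x⟩

/-- On a graph of finite diameter the iterates have a linear growth rate, up to a bounded error.
The values at a base point, corrected by the oscillation, are both sub- and superadditive. -/
theorem exists_growth_rate [Nonempty V] (hs : ∀ x y, Adj x y → Adj y x)
    {N : ℕ} (hN : ∀ x y, Reach Adj N x y) {f : V → ℝ} (hf : IsBdd f) :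
    ∃ c C : ℝ, ∀ (n : ℕ) (x : V), |iter Adj f (fun _ => 0) n x - n * c| ≤ C := by
  obtain ⟨M, hM⟩ := hf
  obtain ⟨p⟩ := ‹Nonempty V›
  have hM0 : 0 ≤ M := (abs_nonneg _).trans (hM p)
  have h0 : IsBdd fun _ : V => (0 : ℝ) := IsBdd.const 0
  have hb : ∀ n, IsBdd (iter Adj f (fun _ => 0) n) := isBdd_iter hr ⟨M, hM⟩ h0
  set u := iter Adj f (fun _ => 0) with hu
  set C : ℝ := 2 * (2 * M) * N * N with hC
  have hosc : ∀ n x y, u n y ≤ u n x + C := by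
    intro n
    refine oscillation_le hr (hb n) hs hN fun y => ?_
    have h1 := (iter_le_iter_succ hr hM n y).1
    have h2 := (abs_le.1 (hM y)).2
    simp only [iter, step] at h1
    linarith
  have hadd : ∀ m n, u (m + n) p ≤ u m p + (u n p + C) ∧ u m p + (u n p - C) ≤ u (m + n) p := by
    intro m n
    rw [hu, iter_add, ← hu]
    have h1 := iter_le_iter hr ⟨M, hM⟩ (hb n) h0 (d := u n p + C)
      (fun y => by linarith [hosc n p y]) m p
    have h2 := iter_le_iter hr ⟨M, hM⟩ h0 (hb n) (d := -(u n p - C))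
      (fun y => by linarith [hosc n y p]) m p
    exact ⟨h1, by linarith⟩
  have hsub1 : Subadditive fun n => u n p + C := fun m n => by linarith [(hadd m n).1]
  have hsub2 : Subadditive fun n => C - u n p := fun m n => by linarith [(hadd m n).2]
  have hC0 : 0 ≤ C := by positivity
  have hup : ∀ n : ℕ, |u n p| ≤ n * M := fun n => by
    simpa using abs_iter_le hr hM (g := fun _ => 0) (K := 0) (by simp) n p
  have hdiv : ∀ (a : ℕ → ℝ), (∀ n : ℕ, -(n * M) ≤ a n) →
      BddBelow (Set.range fun n => a n / n) := by
    intro a ha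
    refine ⟨-M, ?_⟩
    rintro _ ⟨n, rfl⟩
    rcases Nat.eq_zero_or_pos n with rfl | hn
    · simpa using hM0
    · have : (0 : ℝ) < n := by exact_mod_cast hn
      simp only
      rw [le_div_iff₀ this]
      linarith [ha n]
  have hb1 := hdiv (fun n => u n p + C) fun n => by linarith [(abs_le.1 (hup n)).1]
  have hb2 := hdiv (fun n => C - u n p) fun n => by linarith [(abs_le.1 (hup n)).2]
  have ht := (hsub1.tendsto_lim hb1).add (hsub2.tendsto_lim hb2)
  have ht' : Tendsto (fun n : ℕ => (u n p + C) / n + (C - u n p) / n) atTop (𝓝 0) := by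
    have : (fun n : ℕ => (u n p + C) / n + (C - u n p) / n) = fun n : ℕ => (2 * C) / n := by
      funext n
      ring
    rw [this]
    exact tendsto_const_div_atTop_nhds_zero_nat _
  have hsum := tendsto_nhds_unique ht ht'
  refine ⟨hsub1.lim, C + C, fun n x => ?_⟩
  rcases Nat.eq_zero_or_pos n with rfl | hn
  · simp [hu, iter, hC0]
  have hn' : (0 : ℝ) < n := by exact_mod_cast hn
  have l1 := hsub1.lim_le_div hb1 hn.ne'
  have l2 := hsub2.lim_le_div hb2 hn.ne'
  rw [le_div_iff₀ hn'] at l1 l2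
  have e : hsub2.lim = -hsub1.lim := by linarith
  rw [e] at l2
  exact abs_le.2 ⟨by linarith [hosc n x p], by linarith [hosc n p x]⟩

/-- If `c'` is less than the growth rate, the maximum of finitely many of the functions
`uₙ - n c'` is a subsolution with constant `c'`. -/
theorem exists_subsolution {f : V → ℝ} (hf : IsBdd f) {c c' C : ℝ}
    (h : ∀ (n : ℕ) (x : V), |iter Adj f (fun _ => 0) n x - n * c| ≤ C) (hc : c' < c) :
    ∃ w : V → ℝ, IsBdd w ∧ ∀ x, w x + c' ≤ step Adj f w x := by
  have hb : ∀ n, IsBdd (iter Adj f (fun _ => 0) n) := isBdd_iter hr hf (IsBdd.const 0)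
  set u := iter Adj f (fun _ => 0) with hu
  obtain ⟨N, hN⟩ := exists_nat_gt (C / (c - c'))
  rw [div_lt_iff₀ (by linarith)] at hN
  have hne : (Finset.range (N + 1)).Nonempty := ⟨0, by simp⟩
  let w : V → ℝ := fun x => (Finset.range (N + 1)).sup' hne fun n => u n x - n * c'
  have hle : ∀ n ≤ N, ∀ x, u n x - n * c' ≤ w x := fun n hn x =>
    Finset.le_sup' (fun n : ℕ => u n x - n * c') (Finset.mem_range.2 (by omega))
  have hw : IsBdd w := by
    refine ⟨N * |c - c'| + C, fun x => abs_le.2 ⟨?_, Finset.sup'_le _ _ fun n hn => ?_⟩⟩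
    · have h1 := hle 0 (by omega) x
      have h2 : 0 ≤ C := (abs_nonneg _).trans (h 0 x)
      have h3 : 0 ≤ N * |c - c'| := by positivity
      simp [hu, iter] at h1
      linarith
    · have h1 := (abs_le.1 (h n x)).2
      have h2 : (n : ℝ) * (c - c') ≤ N * |c - c'| := by
        have : (n : ℝ) ≤ N := by
          exact_mod_cast Nat.lt_succ_iff.1 (Finset.mem_range.1 hn)
        exact mul_le_mul this (le_abs_self _) (by linarith) (by positivity)
      linarith
  have hstep : ∀ n ≤ N, ∀ x, u (n + 1) x - n * c' ≤ step Adj f w x := fun n hn x => by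
    have := step_le_step (f := f) hr (hb n) hw (d := n * c') (fun y => by linarith [hle n hn y]) x
    simp only [hu, iter] at this ⊢
    linarith
  refine ⟨w, hw, fun x => le_sub_iff_add_le.1 (Finset.sup'_le _ _ fun n hn => ?_)⟩
  rcases n with _ | n
  · have h1 := hstep N le_rfl x
    have h2 := (abs_le.1 (h (N + 1) x)).1
    push_cast at h2
    simp only [hu, iter] at h1 h2 ⊢
    simp only [CharP.cast_eq_zero, zero_mul, sub_zero]
    linarith
  · have h1 := hstep n (by simp at hn; omega) x
    push_cast
    linarith

/-- Conversely, the constant of a subsolution is at most the growth rate. -/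
theorem le_growth_rate [Nonempty V] {f v : V → ℝ} (hf : IsBdd f) (hv : IsBdd v) {c c' C : ℝ}
    (h : ∀ (n : ℕ) (x : V), |iter Adj f (fun _ => 0) n x - n * c| ≤ C)
    (hc : ∀ x, v x + c' ≤ step Adj f v x) : c' ≤ c := by
  obtain ⟨K, hK⟩ := id hv
  obtain ⟨p⟩ := ‹Nonempty V›
  by_contra! hlt
  obtain ⟨n, hn⟩ := exists_nat_gt ((C + 2 * K) / (c' - c))
  rw [div_lt_iff₀ (by linarith)] at hn
  have h1 := add_mul_le_iter hr hf hv hc n p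
  have h2 := iter_le_iter hr hf hv (IsBdd.const 0) (d := K)
    (fun x => by linarith [(abs_le.1 (hK x)).2]) n p
  have h3 := (abs_le.1 (h n p)).2
  have h4 := (abs_le.1 (hK p)).1
  linarith

theorem abs_growth_rate_le [Nonempty V] {f : V → ℝ} {M : ℝ} (hf : ∀ x, |f x| ≤ M) {c C : ℝ}
    (h : ∀ (n : ℕ) (x : V), |iter Adj f (fun _ => 0) n x - n * c| ≤ C) : |c| ≤ M := by
  obtain ⟨p⟩ := ‹Nonempty V›
  by_contra! hlt
  obtain ⟨n, hn⟩ := exists_nat_gt (C / (|c| - M))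
  rw [div_lt_iff₀ (by linarith)] at hn
  have h1 : |iter Adj f (fun _ => 0) n p| ≤ n * M := by
    simpa using abs_iter_le hr hf (g := fun _ => 0) (K := 0) (by simp) n p
  have h2 := abs_sub_abs_le_abs_sub (n * c) (iter Adj f (fun _ => 0) n p)
  rw [abs_sub_comm, abs_mul, Nat.abs_cast] at h2
  linarith [h n p]

end Reflexive

/-! ### The game values are the iterates -/

theorem history_congr {n : ℕ} (S T : Strategy Adj n) (x : V) {ω ω' : Fin n → Bool} (k : ℕ)
    (hk : k ≤ n) (h : ∀ i : Fin n, (i : ℕ) < k → ω i = ω' i) :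
    history S T x ω k hk = history S T x ω' k hk := by
  induction k with
  | zero => rfl
  | succ k ih =>
    have h1 := ih (Nat.le_of_succ_le hk) fun i hi => h i (by omega)
    have h2 : (fun i : Fin (k + 1) => ω (Fin.castLE hk i)) = fun i => ω' (Fin.castLE hk i) := by
      funext i
      exact h _ (by simp; omega)
    have h3 : ω ⟨k, hk⟩ = ω' ⟨k, hk⟩ := h _ (by simp)
    simp only [history, h1, h2, h3]

theorem position_succ {n : ℕ} (S T : Strategy Adj n) (x : V) (ω : Fin n → Bool) (k : ℕ)
    (hk : k + 1 ≤ n) :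
    position S T x ω (k + 1) hk =
      if ω ⟨k, hk⟩ = true then
        S.move ⟨k, hk⟩ (history S T x ω k (Nat.le_of_succ_le hk)) fun i => ω (Fin.castLE hk i)
      else
        T.move ⟨k, hk⟩ (history S T x ω k (Nat.le_of_succ_le hk)) fun i => ω (Fin.castLE hk i) := by
  simp only [position, history, Fin.snoc_last]

/-- The payoff of the first `k` steps followed by the terminal payoff `g`. -/
noncomputable def partialPayoff {n : ℕ} (f g : V → ℝ) (S T : Strategy Adj n) (x : V)
    (ω : Fin n → Bool) (k : ℕ) (hk : k ≤ n) : ℝ :=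
  (∑ j : Fin k, f (position S T x ω j (j.isLt.le.trans hk))) + g (position S T x ω k hk)

/-- The sequence of coin tosses with the toss of step `k` reversed. -/
def flip {n : ℕ} (k : Fin n) (ω : Fin n → Bool) : Fin n → Bool :=
  Function.update ω k (!ω k)

theorem flip_involutive {n : ℕ} (k : Fin n) : Function.Involutive (flip k) := by
  intro ω
  funext i
  by_cases h : i = k
  · subst h; simp [flip]
  · simp [flip, h]

/-- If `w k` is below the average of `f + w (k + 1)` over the two possible moves at every step,
then `w 0` is a lower bound for the expected payoff with terminal payoff `w n`. -/
theorem le_expectedPayoff {n : ℕ} {f : V → ℝ} {w : ℕ → V → ℝ} (S T : Strategy Adj n) (x : V)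
    (h : ∀ (k : Fin n) (pos : Fin (k + 1) → V) (a b : Fin (k + 1) → Bool),
      w k (pos (Fin.last k)) ≤ f (pos (Fin.last k)) +
        (w (k + 1) (S.move k pos a) + w (k + 1) (T.move k pos b)) / 2) :
    w 0 x ≤ expectedPayoff f (w n) S T x := by
  have key : ∀ (k : ℕ) (hk : k ≤ n),
      2 ^ n * w 0 x ≤ ∑ ω : Fin n → Bool, partialPayoff f (w k) S T x ω k hk := by
    intro k
    induction k with
    | zero => intro hk; simp [partialPayoff, position, history]
    | succ k ih =>
      intro hk
      refine (ih (Nat.le_of_succ_le hk)).trans ?_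
      set κ : Fin n := ⟨k, hk⟩
      -- The first `k` moves do not depend on the toss of step `k`, so the tosses are averaged in
      -- pairs that differ in this toss alone.
      have hsum : ∑ ω : Fin n → Bool, partialPayoff f (w (k + 1)) S T x (flip κ ω) (k + 1) hk =
          ∑ ω : Fin n → Bool, partialPayoff f (w (k + 1)) S T x ω (k + 1) hk :=
        Equiv.sum_comp (flip_involutive κ).toPerm
          fun ω => partialPayoff f (w (k + 1)) S T x ω (k + 1) hk
      have hpair : ∀ ω : Fin n → Bool, 2 * partialPayoff f (w k) S T x ω k (Nat.le_of_succ_le hk) ≤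
          partialPayoff f (w (k + 1)) S T x ω (k + 1) hk +
            partialPayoff f (w (k + 1)) S T x (flip κ ω) (k + 1) hk := by
        intro ω
        have hh : ∀ j (hj : j ≤ k), history S T x (flip κ ω) j (hj.trans (Nat.le_of_succ_le hk)) =
            history S T x ω j (hj.trans (Nat.le_of_succ_le hk)) := by
          intro j hj
          refine history_congr S T x j _ fun i hi => ?_
          have : i ≠ κ := by
            rintro rfl
            exact absurd hi (by simp [κ]; omega)
          simp [flip, this]
        have hp : ∀ j (hj : j ≤ k), position S T x (flip κ ω) j (hj.trans (Nat.le_of_succ_le hk)) =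
            position S T x ω j (hj.trans (Nat.le_of_succ_le hk)) := fun j hj => by
          simp only [position, hh j hj]
        have hfs : ∑ j : Fin (k + 1), f (position S T x (flip κ ω) j (j.isLt.le.trans hk)) =
            ∑ j : Fin (k + 1), f (position S T x ω j (j.isLt.le.trans hk)) :=
          Finset.sum_congr rfl fun j _ => by rw [hp j (by omega)]
        have hflip : flip κ ω κ = !ω κ := by simp [flip]
        have hlast : ∑ j : Fin (k + 1), f (position S T x ω j (j.isLt.le.trans hk)) =
            (∑ j : Fin k, f (position S T x ω j (j.isLt.le.trans (Nat.le_of_succ_le hk)))) +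
              f (position S T x ω k (Nat.le_of_succ_le hk)) := by
          rw [Fin.sum_univ_castSucc]; rfl
        have hmove := h κ (history S T x ω k (Nat.le_of_succ_le hk))
        simp only [partialPayoff]
        rw [hfs, hlast, position_succ, position_succ, hh k le_rfl]
        have h1 := hmove (fun i => ω (Fin.castLE hk i)) (fun i => flip κ ω (Fin.castLE hk i))
        have h2 := hmove (fun i => flip κ ω (Fin.castLE hk i)) (fun i => ω (Fin.castLE hk i))
        change w k (position S T x ω k _) ≤ f (position S T x ω k _) + _ at h1 h2
        change _ ≤ (_ + w (k + 1) (if ω κ = true then _ else _)) +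
          (_ + w (k + 1) (if flip κ ω κ = true then _ else _))
        rw [hflip]
        cases ω κ <;> simp only [Bool.not_true, Bool.not_false, if_true, Bool.false_eq_true,
          if_false] <;> linarith
      have h1 := Finset.sum_le_sum fun (ω : Fin n → Bool) (_ : ω ∈ Finset.univ) => hpair ω
      rw [Finset.sum_add_distrib, hsum, ← Finset.mul_sum] at h1
      linarith
  have h1 := key n le_rfl
  rw [expectedPayoff, le_div_iff₀ (by positivity), mul_comm]
  exact h1

theorem expectedPayoff_neg {n : ℕ} (f g : V → ℝ) (S T : Strategy Adj n) (x : V) :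
    expectedPayoff (fun y => -f y) (fun y => -g y) S T x = -expectedPayoff f g S T x := by
  have : ∀ ω, payoff (fun y => -f y) (fun y => -g y) S T x ω = -payoff f g S T x ω := fun ω => by
    simp only [payoff, Finset.sum_neg_distrib]
    ring
  simp only [expectedPayoff, this, Finset.sum_neg_distrib, neg_div]

theorem expectedPayoff_le {n : ℕ} {f : V → ℝ} {w : ℕ → V → ℝ} (S T : Strategy Adj n) (x : V)
    (h : ∀ (k : Fin n) (pos : Fin (k + 1) → V) (a b : Fin (k + 1) → Bool),
      f (pos (Fin.last k)) + (w (k + 1) (S.move k pos a) + w (k + 1) (T.move k pos b)) / 2 ≤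
        w k (pos (Fin.last k))) :
    expectedPayoff f (w n) S T x ≤ w 0 x := by
  have := le_expectedPayoff (f := fun y => -f y) (w := fun k y => -w k y) S T x
    fun k pos a b => by linarith [h k pos a b]
  rw [expectedPayoff_neg] at this
  linarith

theorem expectedPayoff_add_const {n : ℕ} (f g : V → ℝ) (a : ℝ) (S T : Strategy Adj n) (x : V) :
    expectedPayoff f (fun y => g y + a) S T x = expectedPayoff f g S T x + a := by
  simp only [expectedPayoff, payoff, ← add_assoc]
  rw [Finset.sum_add_distrib, add_div]
  simp

theorem abs_expectedPayoff_le {n : ℕ} {f g : V → ℝ} {M K : ℝ} (hf : ∀ x, |f x| ≤ M)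
    (hg : ∀ x, |g x| ≤ K) (S T : Strategy Adj n) (x : V) :
    |expectedPayoff f g S T x| ≤ n * M + K := by
  have hp : ∀ ω, |payoff f g S T x ω| ≤ n * M + K := fun ω => by
    refine (abs_add_le _ _).trans (add_le_add ?_ (hg _))
    refine (Finset.abs_sum_le_sum_abs _ _).trans ?_
    simpa using Finset.sum_le_card_nsmul Finset.univ _ M
      fun (k : Fin n) _ => hf (position S T x ω k k.isLt.le)
  rw [expectedPayoff, abs_div, abs_of_pos (by positivity : (0 : ℝ) < 2 ^ n),
    div_le_iff₀ (by positivity)]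
  refine (Finset.abs_sum_le_sum_abs _ _).trans ?_
  refine (Finset.sum_le_card_nsmul Finset.univ _ _ fun ω _ => hp ω).trans (le_of_eq ?_)
  simp [mul_comm]
  ring

section Reflexive

variable (hr : ∀ x, Adj x x)
include hr

/-- Moving at each step to a neighbour that is within `τ` of the supremum of the value of the
remaining game guarantees Player I the iterate up to `n τ`, whatever Player II does. -/
theorem exists_strategyI {f g : V → ℝ} (hf : IsBdd f) (hg : IsBdd g) (n : ℕ) {τ : ℝ} (hτ : 0 < τ) :
    ∃ S : Strategy Adj n, ∀ (T : Strategy Adj n) (x : V),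
      iter Adj f g n x ≤ expectedPayoff f g S T x + n * τ := by
  have hb : ∀ n, IsBdd (iter Adj f g n) := isBdd_iter hr hf hg
  have hex : ∀ (k : ℕ) (x : V), ∃ y, Adj x y ∧
      nbrSup Adj (iter Adj f g k) x - τ ≤ iter Adj f g k y := by
    intro k x
    by_contra! hc
    have := nbrSup_le hr (u := iter Adj f g k) (x := x) fun y hy => (hc y hy).le
    linarith
  choose m hm1 hm2 using hex
  refine ⟨⟨fun k pos _ => m (n - (k + 1)) (pos (Fin.last k)), fun k pos _ => hm1 _ _⟩,
    fun T x => ?_⟩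
  have := le_expectedPayoff (f := f) (w := fun k y => iter Adj f g (n - k) y + k * τ)
    ⟨fun k pos _ => m (n - (k + 1)) (pos (Fin.last k)), fun k pos _ => hm1 _ _⟩ T x ?_
  · rw [expectedPayoff_add_const] at this
    simpa [iter] using this
  · intro k pos a b
    have hk : n - (k : ℕ) = (n - (k + 1)) + 1 := by omega
    have h1 := hm2 (n - (k + 1)) (pos (Fin.last k))
    have h2 := nbrInf_le (hb (n - (k + 1))) (T.adj_move k pos b)
    rw [hk]
    simp only [iter, step]
    push_cast
    linarith

theorem exists_strategyII {f g : V → ℝ} (hf : IsBdd f) (hg : IsBdd g) (n : ℕ) {τ : ℝ}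
    (hτ : 0 < τ) :
    ∃ T : Strategy Adj n, ∀ (S : Strategy Adj n) (x : V),
      expectedPayoff f g S T x ≤ iter Adj f g n x + n * τ := by
  have hb : ∀ n, IsBdd (iter Adj f g n) := isBdd_iter hr hf hg
  have hex : ∀ (k : ℕ) (x : V), ∃ y, Adj x y ∧
      iter Adj f g k y ≤ nbrInf Adj (iter Adj f g k) x + τ := by
    intro k x
    by_contra! hc
    have := le_nbrInf hr (u := iter Adj f g k) (x := x) fun y hy => (hc y hy).le
    linarith
  choose m hm1 hm2 using hex
  refine ⟨⟨fun k pos _ => m (n - (k + 1)) (pos (Fin.last k)), fun k pos _ => hm1 _ _⟩,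
    fun S x => ?_⟩
  have := expectedPayoff_le (f := f) (w := fun k y => iter Adj f g (n - k) y + -(k * τ)) S
    ⟨fun k pos _ => m (n - (k + 1)) (pos (Fin.last k)), fun k pos _ => hm1 _ _⟩ x ?_
  · rw [expectedPayoff_add_const] at this
    simp [iter] at this
    linarith
  · intro k pos a b
    have hk : n - (k : ℕ) = (n - (k + 1)) + 1 := by omega
    have h1 := hm2 (n - (k + 1)) (pos (Fin.last k))
    have h2 := le_nbrSup (hb (n - (k + 1))) (S.adj_move k pos a)
    rw [hk]
    simp only [iter, step]
    push_cast
    linarith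

theorem isGameValues_iter {f g : V → ℝ} (hf : IsBdd f) (hg : IsBdd g) :
    IsGameValues Adj f g (iter Adj f g) := by
  intro n x
  obtain ⟨M, hM⟩ := id hf
  obtain ⟨K, hK⟩ := id hg
  have hE := fun S T => abs_le.1 (abs_expectedPayoff_le hM hK (n := n) (Adj := Adj) S T x)
  have : Nonempty (Strategy Adj n) := ⟨⟨fun _ pos _ => pos (Fin.last _), fun _ _ _ => hr _⟩⟩
  have bT : ∀ S : Strategy Adj n, BddBelow (Set.range fun T => expectedPayoff f g S T x) :=
    fun S => ⟨_, by rintro _ ⟨T, rfl⟩; exact (hE S T).1⟩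
  have bS : ∀ T : Strategy Adj n, BddAbove (Set.range fun S => expectedPayoff f g S T x) :=
    fun T => ⟨_, by rintro _ ⟨S, rfl⟩; exact (hE S T).2⟩
  have bI : BddAbove (Set.range fun S : Strategy Adj n => ⨅ T, expectedPayoff f g S T x) :=
    ⟨_, by rintro _ ⟨S, rfl⟩; exact (ciInf_le (bT S) S).trans (hE S S).2⟩
  have bII : BddBelow (Set.range fun T : Strategy Adj n => ⨆ S, expectedPayoff f g S T x) :=
    ⟨_, by rintro _ ⟨T, rfl⟩; exact (hE T T).1.trans (le_ciSup (bS T) T)⟩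
  have hτ : ∀ η : ℝ, 0 < η → ∃ τ : ℝ, 0 < τ ∧ n * τ ≤ η := fun η hη =>
    ⟨η / (n + 1), by positivity, by
      rw [mul_div_assoc', div_le_iff₀ (by positivity)]
      nlinarith⟩
  refine ⟨le_antisymm ?_ ?_, le_antisymm ?_ ?_⟩
  all_goals
    refine le_of_forall_pos_le_add fun η hη => ?_
    obtain ⟨τ, hτ0, hτη⟩ := hτ η hη
    obtain ⟨S, hS⟩ := exists_strategyI hr hf hg n hτ0
    obtain ⟨T, hT⟩ := exists_strategyII hr hf hg n hτ0
  · exact ciSup_le fun S' => (ciInf_le (bT S') T).trans (by linarith [hT S' x])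
  · have h1 : iter Adj f g n x - n * τ ≤ ⨅ T', expectedPayoff f g S T' x :=
      le_ciInf fun T' => by linarith [hS T' x]
    have h2 := h1.trans (le_ciSup bI S)
    rw [valueI]
    linarith
  · have h1 : (⨆ S', expectedPayoff f g S' T x) ≤ iter Adj f g n x + n * τ :=
      ciSup_le fun S' => hT S' x
    have h2 := (ciInf_le bII T).trans h1
    rw [valueII]
    linarith
  · have h1 : iter Adj f g n x - n * τ ≤ valueII Adj f g n x :=
      le_ciInf fun T' => le_trans (by linarith [hS T' x]) (le_ciSup (bS T') S)
    linarith

/-- The growth rate of the iterates is the unique long term advantage: by nonexpansiveness it does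
not depend on the terminal payoff. -/
theorem isLongTermAdvantage_iff [Nonempty V] {f : V → ℝ} (hf : IsBdd f) {c C : ℝ}
    (h : ∀ (n : ℕ) (x : V), |iter Adj f (fun _ => 0) n x - n * c| ≤ C) (a : ℝ) :
    IsLongTermAdvantage Adj f a ↔ a = c := by
  constructor
  · intro ha
    obtain ⟨u, hu, C', hC'⟩ := ha (fun _ => 0) (IsBdd.const 0)
    obtain ⟨p⟩ := ‹Nonempty V›
    by_contra hne
    have hpos : 0 < |a - c| := abs_pos.2 (sub_ne_zero.2 hne)
    obtain ⟨n, hn⟩ := exists_nat_gt ((C + C') / |a - c|)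
    rw [div_lt_iff₀ hpos] at hn
    have e : iter Adj f (fun _ => 0) n p = u n p :=
      (isGameValues_iter hr hf (IsBdd.const 0) n p).1.symm.trans (hu n p).1
    have h1 := h n p
    have h2 := hC' n p
    rw [e] at h1
    have h3 : (n : ℝ) * |a - c| = |(u n p - n * c) - (u n p - n * a)| := by
      rw [← Nat.abs_cast n, ← abs_mul, Nat.abs_cast]
      congr 1
      ring
    have h4 := abs_sub (u n p - n * c) (u n p - n * a)
    linarith
  · rintro rfl g ⟨K, hK⟩
    refine ⟨iter Adj f g, isGameValues_iter hr hf ⟨K, hK⟩, C + K, fun n x => ?_⟩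
    have h1 := iter_le_iter hr hf ⟨K, hK⟩ (IsBdd.const 0) (d := K)
      (fun y => by linarith [(abs_le.1 (hK y)).2]) n x
    have h2 := iter_le_iter hr hf (IsBdd.const 0) ⟨K, hK⟩ (d := K)
      (fun y => by linarith [(abs_le.1 (hK y)).1]) n x
    have h3 := abs_le.1 (h n x)
    exact abs_le.2 ⟨by linarith, by linarith⟩

end Reflexive

/-! ### Comparison of step sizes in a length space -/

theorem Reach.split {j k : ℕ} {x z : V} (h : Reach Adj (j + k) x z) :
    ∃ y, Reach Adj j x y ∧ Reach Adj k y z := by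
  induction k generalizing z with
  | zero => exact ⟨z, h, rfl⟩
  | succ k ih =>
    obtain ⟨w, hw, hz⟩ := h
    obtain ⟨y, hy, hyw⟩ := ih hw
    exact ⟨y, hy, w, hyw, hz⟩

section Metric

variable [MetricSpace V]

theorem epsAdj_refl {ε : ℝ} (hε : 0 ≤ ε) (x : V) : EpsAdj ε x x := by
  simpa [EpsAdj] using hε

theorem epsAdj_symm {ε : ℝ} (x y : V) (h : EpsAdj ε x y) : EpsAdj ε y x := by
  rwa [EpsAdj, dist_comm]

theorem Reach.dist_le {δ : ℝ} {k : ℕ} {x y : V} (h : Reach (EpsAdj δ) k x y) :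
    dist x y ≤ k * δ := by
  induction k generalizing y with
  | zero => obtain rfl : x = y := h; simp
  | succ k ih =>
    obtain ⟨z, hz, hy⟩ := h
    have h1 := dist_triangle x z y
    have h2 := ih hz
    have h3 : dist z y ≤ δ := hy
    push_cast
    linarith

/-- The end of a path is reached greedily: each step goes to a later point of the path at distance
exactly `δ`, and uses up at least `δ` of the length. -/
theorem reach_of_eVariationOn_lt {δ : ℝ} (hδ : 0 < δ) {x y : V} (γ : Path x y) (k : ℕ) :
    ∀ s : unitInterval, eVariationOn γ (Set.Ici s) < ENNReal.ofReal (k * δ) →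
      Reach (EpsAdj δ) k (γ s) y := by
  induction k with
  | zero => intro s hs; simp at hs
  | succ k ih =>
    intro s hs
    by_cases hd : dist (γ s) y ≤ δ
    · have := (reach_one (Adj := EpsAdj δ) hd).trans (reach_self (epsAdj_refl hδ.le) k y)
      rwa [add_comm] at this
    · have hcont : Continuous fun t : unitInterval => dist (γ s) (γ (max s t)) := by fun_prop
      obtain ⟨t, ht⟩ := mem_range_of_exists_le_of_exists_ge (c := δ) hcont
        ⟨s, by simpa using hδ.le⟩
        ⟨1, by simpa [max_eq_right unitInterval.le_one'] using (not_le.1 hd).le⟩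
      change dist (γ s) (γ (max s t)) = δ at ht
      have hst : s ≤ max s t := le_max_left _ _
      have h1 := eVariationOn.edist_le γ (s := Set.Icc s (max s t)) (x := s) (y := max s t)
        ⟨le_rfl, hst⟩ ⟨hst, le_rfl⟩
      rw [edist_dist, ht] at h1
      have h2 := eVariationOn.add_le_union γ (s := Set.Icc s (max s t)) (t := Set.Ici (max s t))
        fun a ha b hb => ha.2.trans hb
      have h3 := eVariationOn.mono γ (t := Set.Icc s (max s t) ∪ Set.Ici (max s t))
        (s := Set.Ici s) (Set.union_subset Set.Icc_subset_Ici_self (Set.Ici_subset_Ici.2 hst))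
      have h4 : ENNReal.ofReal (((k + 1 : ℕ) : ℝ) * δ) =
          ENNReal.ofReal δ + ENNReal.ofReal (k * δ) := by
        rw [← ENNReal.ofReal_add hδ.le (by positivity)]
        congr 1
        push_cast
        ring
      rw [h4] at hs
      have h5 : eVariationOn γ (Set.Ici (max s t)) < ENNReal.ofReal (k * δ) :=
        lt_of_add_lt_add_left (((add_le_add_left h1 _).trans (h2.trans h3)).trans_lt hs)
      have := (reach_one (Adj := EpsAdj δ) (ht.le : EpsAdj δ _ _)).trans (ih _ h5)
      rwa [add_comm] at this

theorem reach_of_dist_lt (hV : IsLengthSpace V) {δ : ℝ} (hδ : 0 < δ) {k : ℕ} {x y : V}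
    (h : dist x y < k * δ) : Reach (EpsAdj δ) k x y := by
  have h1 : edist x y < ENNReal.ofReal (k * δ) := by
    rw [edist_dist]
    exact (ENNReal.ofReal_lt_ofReal_iff (dist_nonneg.trans_lt h)).2 h
  rw [hV x y, iInf_lt_iff] at h1
  obtain ⟨γ, hγ⟩ := h1
  have := reach_of_eVariationOn_lt hδ γ k 0
    ((eVariationOn.mono _ (Set.subset_univ _)).trans_lt hγ)
  rwa [γ.source] at this

end Metric

/-- Second differences that are at least `s` with step `1` are at least `m² s` with step `m`. -/
theorem mul_sq_le_of_second_difference {a : ℕ → ℝ} {s : ℝ} {m : ℕ}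
    (h : ∀ j, j + 2 ≤ m + m → s ≤ a (j + 2) - 2 * a (j + 1) + a j) :
    m ^ 2 * s ≤ a (m + m) - 2 * a m + a 0 := by
  have h1 : ∀ k i, i + k + 1 ≤ m + m →
      a (i + 1) - a i + k * s ≤ a (i + k + 1) - a (i + k) := by
    intro k
    induction k with
    | zero => intro i _; simp
    | succ k ih =>
      intro i hi
      have e1 := ih i (by omega)
      have e2 := h (i + k) (by omega)
      rw [← add_assoc]
      push_cast
      linarith
  have h2 : ∀ n ≤ m, a n - a 0 + n * (m * s) ≤ a (n + m) - a m := by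
    intro n
    induction n with
    | zero => intro _; simp
    | succ n ih =>
      intro hn
      have e1 := ih (by omega)
      have e2 := h1 m n (by omega)
      rw [show n + 1 + m = n + m + 1 by ring]
      push_cast
      linarith
  linarith [h2 m le_rfl]

section Metric

variable [MetricSpace V]

/-- A subsolution `w` for step size `δ` yields one for a larger step size `ε`, where
`m δ ≤ ε < (m + 1) δ`: the supremum of `w` over the `ε`-balls, divided by `m²`. The constant drops
by the oscillation `η` of `f` at distance `2 ε`, and by an error that comes from the
difference between `ε` and `m δ`. -/
theorem exists_subsolution_of_small_step (hV : IsLengthSpace V) {f w : V → ℝ} {M c η δ ε : ℝ}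
    (hf : ∀ x, |f x| ≤ M) (hη : ∀ x y, dist x y ≤ 2 * ε → f y ≤ f x + η) (hδ : 0 < δ)
    {m N : ℕ} (hm : 0 < m) (hm1 : m * δ ≤ ε) (hm2 : ε < (m + 1) * δ)
    (hN : ∀ x y : V, Reach (EpsAdj δ) N x y) (hw : IsBdd w)
    (h : ∀ x, w x + c ≤ step (EpsAdj δ) f w x) :
    ∃ v : V → ℝ, IsBdd v ∧
      ∀ x, v x + (c - η - 2 * (M + |c|) * N / m ^ 2) ≤ step (EpsAdj ε) f v x := by
  have hmR : (0 : ℝ) < m := by exact_mod_cast hm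
  have hε : 0 < ε := (mul_pos hmR hδ).trans_le hm1
  have hm2pos : (0 : ℝ) < m ^ 2 := by positivity
  have hr := epsAdj_refl (V := V) hδ.le
  have hrε := epsAdj_refl (V := V) hε.le
  have hs := epsAdj_symm (V := V) (ε := δ)
  let v : V → ℝ := fun x => nbrSup (EpsAdj ε) w x / m ^ 2
  have hvm : ∀ x, m ^ 2 * v x = nbrSup (EpsAdj ε) w x := fun x => by
    simp only [v]
    field_simp
  have hv : IsBdd v := by
    obtain ⟨K, hK⟩ := id hw
    refine ⟨K / m ^ 2, fun x => ?_⟩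
    rw [abs_div, abs_of_pos hm2pos]
    gcongr
    refine abs_le.2 ⟨(abs_le.1 (hK x)).1.trans (le_nbrSup hw (hrε x)), ?_⟩
    exact nbrSup_le hrε fun y _ => (abs_le.1 (hK y)).2
  refine ⟨v, hv, fun x => ?_⟩
  set a := ballSup (EpsAdj δ) w x with ha
  have hadj : ∀ {y z : V}, Reach (EpsAdj δ) m y z → EpsAdj ε y z := fun h => h.dist_le.trans hm1
  have h1 : a (m + m) ≤ m ^ 2 * nbrSup (EpsAdj ε) v x := by
    refine ballSup_le hr fun z hz => ?_
    obtain ⟨y, hy, hyz⟩ := hz.split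
    calc w z ≤ nbrSup (EpsAdj ε) w y := le_nbrSup hw (hadj hyz)
      _ = m ^ 2 * v y := (hvm y).symm
      _ ≤ _ := by gcongr; exact le_nbrSup hv (hadj hy)
  have h2 : a 0 ≤ m ^ 2 * nbrInf (EpsAdj ε) v x := by
    rw [ha, ballSup_zero, ← div_le_iff₀' hm2pos]
    refine le_nbrInf hrε fun y hy => ?_
    rw [div_le_iff₀' hm2pos, hvm]
    exact le_nbrSup hw (epsAdj_symm _ _ hy)
  have h3 : m ^ 2 * v x ≤ a (m + 1) := by
    rw [hvm]
    refine nbrSup_le hrε fun y hy => le_ballSup hw (reach_of_dist_lt hV hδ ?_)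
    push_cast
    exact lt_of_le_of_lt hy hm2
  have h4 : a (m + 1) - a m ≤ 2 * (M + |c|) * N := by
    refine ballSup_increment_le hr hw hs hN (fun y => ?_) x m
    have e1 := h y
    have e2 := (abs_le.1 (hf y)).2
    have e3 := neg_abs_le c
    simp only [step] at e1
    linarith
  have h5 : m ^ 2 * (2 * (c - f x - η)) ≤ a (m + m) - 2 * a m + a 0 := by
    refine mul_sq_le_of_second_difference fun j hj =>
      ballSup_second_difference hr hw hs fun y hy => ?_
    have e1 := h y
    have e2 : f y ≤ f x + η := by
      refine hη x y (hy.dist_le.trans ?_)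
      have : ((j + 1 : ℕ) : ℝ) ≤ 2 * m := by exact_mod_cast (by omega : j + 1 ≤ 2 * m)
      nlinarith
    simp only [step] at e1
    linarith
  have h6 : (m : ℝ) ^ 2 * (2 * (M + |c|) * N / m ^ 2) = 2 * (M + |c|) * N := by field_simp
  have h7 : (m : ℝ) ^ 2 * (v x + (c - η - 2 * (M + |c|) * N / m ^ 2)) ≤
      m ^ 2 * step (EpsAdj ε) f v x := by
    rw [mul_add, mul_sub, h6]
    simp only [step]
    linarith
  exact le_of_mul_le_mul_left h7 hm2pos

/-- The iterates for the step size `ε` grow at rate `c`. -/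
def IsGrowthRate (f : V → ℝ) (ε c : ℝ) : Prop :=
  ∃ C : ℝ, ∀ (n : ℕ) (x : V), |iter (EpsAdj ε) f (fun _ => 0) n x - n * c| ≤ C

/-- For fixed small `ε`, the growth rate of any much smaller step size `δ` exceeds that of `ε` by
little. -/
theorem growth_rate_le_add [CompactSpace V] [Nonempty V] (hV : IsLengthSpace V) {f : V → ℝ}
    (hf : Continuous f) {M : ℝ} (hM : ∀ x, |f x| ≤ M) {c : ℝ → ℝ}
    (hc : ∀ ε, 0 < ε → IsGrowthRate f ε (c ε)) {η : ℝ} (hη : 0 < η) :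
    ∀ᶠ ε in 𝓝[>] (0 : ℝ), ∀ᶠ δ in 𝓝[>] (0 : ℝ), c δ ≤ c ε + η := by
  have hM0 : 0 ≤ M := (abs_nonneg _).trans (hM (Classical.arbitrary V))
  obtain ⟨ε₁, hε₁, huc⟩ := Metric.uniformContinuous_iff.1
    (CompactSpace.uniformContinuous_of_continuous hf) (η / 3) (by positivity)
  obtain ⟨D, hD⟩ := (Metric.isBounded_iff.1 (isCompact_univ (X := V)).isBounded)
  have hD' : ∀ x y : V, dist x y ≤ D := fun x y => hD (Set.mem_univ x) (Set.mem_univ y)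
  have hD0 : 0 ≤ D := dist_nonneg.trans (hD' (Classical.arbitrary V) (Classical.arbitrary V))
  filter_upwards [Ioo_mem_nhdsGT (show (0 : ℝ) < ε₁ / 2 by positivity)] with ε hε
  obtain ⟨hε, hεε⟩ := hε
  have hbd : 0 < η * ε ^ 2 / (24 * (2 * M + 1) * (D + ε)) := by positivity
  filter_upwards [Ioo_mem_nhdsGT (show (0 : ℝ) < ε / 2 by positivity), Ioo_mem_nhdsGT hbd]
    with δ hδ1 hδ2
  obtain ⟨hδ, hδε⟩ := hδ1
  have hδb := hδ2.2
  rw [lt_div_iff₀ (by positivity)] at hδb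
  set m := ⌊ε / δ⌋₊ with hm
  set N := ⌊D / δ⌋₊ + 1 with hN
  have hm1 : m * δ ≤ ε := (le_div_iff₀ hδ).1 (Nat.floor_le (by positivity))
  have hm2 : ε < (m + 1) * δ := (div_lt_iff₀ hδ).1 (Nat.lt_floor_add_one _)
  have hmpos : 0 < m := by
    rw [hm, Nat.floor_pos, le_div_iff₀ hδ]
    linarith
  have hN1 : D < N * δ := by
    rw [hN]
    push_cast
    exact (div_lt_iff₀ hδ).1 (Nat.lt_floor_add_one _)
  have hN2 : N * δ ≤ D + δ := by
    have := (le_div_iff₀ hδ).1 (Nat.floor_le (show 0 ≤ D / δ by positivity))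
    rw [hN]
    push_cast
    linarith
  obtain ⟨C, hC⟩ := hc δ hδ
  obtain ⟨C', hC'⟩ := hc ε hε
  have hcM := abs_growth_rate_le (epsAdj_refl hδ.le) hM hC
  have hmin : 0 < min 1 (η / 3) := by positivity
  obtain ⟨w, hw, hw'⟩ := exists_subsolution (epsAdj_refl hδ.le) ⟨M, hM⟩ hC
    (show c δ - min 1 (η / 3) < c δ by linarith)
  obtain ⟨v, hv, hv'⟩ := exists_subsolution_of_small_step hV hM (η := η / 3) (ε := ε)
    (fun x y hxy => by
      have := huc (show dist x y < ε₁ by linarith)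
      rw [Real.dist_eq] at this
      linarith [(abs_lt.1 this).1])
    hδ hmpos hm1 hm2 (fun x y => reach_of_dist_lt hV hδ ((hD' x y).trans_lt hN1)) hw hw'
  have hle := le_growth_rate (epsAdj_refl hε.le) ⟨M, hM⟩ hv hC' hv'
  have habs : |c δ - min 1 (η / 3)| ≤ M + 1 := by
    have := abs_sub (c δ) (min 1 (η / 3))
    rw [abs_of_pos hmin] at this
    linarith [min_le_left 1 (η / 3)]
  -- The step size `δ` is so small that `N / m²`, which is of order `D δ / ε²`, is negligible.
  have herr : 2 * (M + |c δ - min 1 (η / 3)|) * N / m ^ 2 ≤ η / 3 := by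
    have hmR : (0 : ℝ) < m := by exact_mod_cast hmpos
    have e1 : ε ≤ 2 * (m * δ) := by linarith
    have e2 : ε ^ 2 ≤ 4 * (m * δ) ^ 2 := by nlinarith
    have e3 : 2 * (M + |c δ - min 1 (η / 3)|) * N ≤ 2 * (2 * M + 1) * N :=
      mul_le_mul_of_nonneg_right (by linarith) (Nat.cast_nonneg _)
    rw [div_le_iff₀ (by positivity)]
    refine e3.trans ?_
    have e4 : 2 * (2 * M + 1) * (N * δ) * δ ≤ η / 3 * (m * δ) ^ 2 := by
      calc 2 * (2 * M + 1) * (N * δ) * δ ≤ 2 * (2 * M + 1) * (D + ε) * δ := by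
            gcongr
            linarith
        _ ≤ η / 12 * ε ^ 2 := by linarith
        _ ≤ η / 12 * (4 * (m * δ) ^ 2) := by gcongr
        _ = _ := by ring
    have e5 : 0 < δ ^ 2 := by positivity
    refine le_of_mul_le_mul_right ?_ e5
    calc 2 * (2 * M + 1) * N * δ ^ 2 = 2 * (2 * M + 1) * (N * δ) * δ := by ring
      _ ≤ _ := e4
      _ = _ := by ring
  linarith [min_le_right 1 (η / 3)]

end Metric

/-- The one-sided Cauchy condition `h` says that the upper limit is at most `c i + η` for `i` far
along the filter, hence that it is at most the lower limit. -/
theorem exists_tendsto_of_eventually_eventually_le {ι : Type*} {l : Filter ι} [l.NeBot]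
    {c : ι → ℝ} {M : ℝ} (hM : ∀ᶠ i in l, |c i| ≤ M)
    (h : ∀ η : ℝ, 0 < η → ∀ᶠ i in l, ∀ᶠ j in l, c j ≤ c i + η) :
    ∃ L : ℝ, Tendsto c l (𝓝 L) := by
  have hle : IsBoundedUnder (· ≤ ·) l c :=
    isBoundedUnder_of_eventually_le (hM.mono fun i hi => (abs_le.1 hi).2)
  have hge : IsBoundedUnder (· ≥ ·) l c :=
    isBoundedUnder_of_eventually_ge (hM.mono fun i hi => (abs_le.1 hi).1)
  refine ⟨limsup c l, tendsto_of_le_liminf_of_limsup_le ?_ le_rfl hle hge⟩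
  refine le_of_forall_pos_le_add fun η hη => ?_
  rw [← sub_le_iff_le_add]
  refine le_liminf_of_le hle.isCoboundedUnder_ge ((h η hη).mono fun i hi => ?_)
  rw [sub_le_iff_le_add]
  exact limsup_le_of_le hge.isCoboundedUnder_le hi

end TugOfWar

theorem theorem1p4 {V : Type*} [MetricSpace V] [CompactSpace V] [Nonempty V]
    (hV : IsLengthSpace V) (f : V → ℝ) (hf : Continuous f) :
    ∃ c : ℝ → ℝ,
      (∀ ε : ℝ, 0 < ε → ∀ a : ℝ,
        TugOfWar.IsLongTermAdvantage (EpsAdj (V := V) ε) f a ↔ a = c ε) ∧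
      ∃ L : ℝ, Tendsto c (𝓝[>] 0) (𝓝 L) := by
  obtain ⟨M, hM⟩ : ∃ M : ℝ, ∀ x, |f x| ≤ M := by
    obtain ⟨M, hM⟩ := (isCompact_univ (X := V)).exists_bound_of_continuousOn hf.continuousOn
    exact ⟨M, fun x => hM x (Set.mem_univ x)⟩
  have hex : ∀ ε : ℝ, ∃ c : ℝ, 0 < ε → TugOfWar.IsGrowthRate f ε c := by
    intro ε
    by_cases hε : 0 < ε
    · obtain ⟨D, hD⟩ := Metric.isBounded_iff.1 (isCompact_univ (X := V)).isBounded
      obtain ⟨N, hN⟩ := exists_nat_gt (D / ε)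
      rw [div_lt_iff₀ hε] at hN
      obtain ⟨c, hc⟩ := TugOfWar.exists_growth_rate (TugOfWar.epsAdj_refl hε.le)
        TugOfWar.epsAdj_symm (N := N) (f := f)
        (fun x y : V => TugOfWar.reach_of_dist_lt hV hε
          ((hD (Set.mem_univ x) (Set.mem_univ y)).trans_lt hN)) ⟨M, hM⟩
      exact ⟨c, fun _ => hc⟩
    · exact ⟨0, fun h => absurd h hε⟩
  choose c hc using hex
  refine ⟨c, fun ε hε a => ?_, TugOfWar.exists_tendsto_of_eventually_eventually_le (M := M) ?_
    fun η hη => TugOfWar.growth_rate_le_add hV hf hM hc hη⟩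
  · obtain ⟨C, hC⟩ := hc ε hε
    exact TugOfWar.isLongTermAdvantage_iff (TugOfWar.epsAdj_refl hε.le) ⟨M, hM⟩ hC a
  · filter_upwards [self_mem_nhdsWithin] with ε hε
    obtain ⟨C, hC⟩ := hc ε hε
    exact TugOfWar.abs_growth_rate_le (TugOfWar.epsAdj_refl (le_of_lt hε)) hM hC
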